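/- Let $U\subset\mathbb R^n$ be open and $f\in C^2(U\times\mathbb R,\mathbb R^n)$. Let $\Lambda\in C^2(\mathbb R,(\lambda_-,\lambda_+))$ satisfy $\Lambda(s)\to\lambda_\pm$ and $\Lambda'(s)\to0$ as $s\to\pm\infty$. An equilibrium $p\in U$ of $\dot x=f(x,\lambda)$ is called attracting if it is Lyapunov stable and its basin $\mathbb B(p,\lambda)$ (the set of all initial values in $U$ whose solution stays in $U$ for all $t\ge0$ and converges to $p$) is a neighbourhood of $p$. Let $(X(s),\Lambda(s))$ be a stable path: for every $s\in\mathbb R$, $X(s)$ is an attracting equilibrium of $\dot x=f(x,\Lambda(s))$, the limits $X_\pm=\lim_{s\to\pm\infty}X(s)$ exist, and $X_\pm$ are attracting equilibria of $\dot x=f(x,\lambda_\pm)$. Suppose that the path is forward inflowing stable, that is, there are compact sets $K(s)\subset\mathbb R^n$, $s\in\mathbb R$, such that 1. $X(s)\in\operatorname{Int}K(s)$ for all $s$; 2. $K(s_1)\subset K(s_2)$ whenever $s_1<s_2$; 3. for all $s$ and all $x\in\partial K(s)$ the vector $f(x,\Lambda(s))$ points strictly into $K(s)$, i.e. $x+h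 f(x,\Lambda(s))\in\operatorname{Int}K(s)$ for all sufficiently small $h>0$; 4. $X_\pm\in\operatorname{Int}K_\pm$, where $K_-=\bigcap_sK(s)$ and $K_+=\overline{\bigcup_sK(s)}$; 5. $K_+$ is compact and $K_+\subset\mathbb B(X_+,\lambda_+)$. For $r>0$, a pullback attractor to $X_-$ is a solution $x^r$ of $\dot x=f(x,\Lambda(rt))$ in $U$ with $x^r(t)\to X_-$ as $t\to-\infty$, defined on its maximal interval of existence $(-\infty,b)$, $b\le\infty$. Then for every $r>0$ a pullback attractor to $X_-$ exists, and every pullback attractor $x^r$ to $X_-$ endpoint tracks the path: it is defined for all $t\in\mathbb R$ and $x^r(t)\to X_+$ as $t\to\infty$. Moreover, the pullback attractor is unique if all eigenvalues of $\partial_xf(X_-,\lambda_-)$ have negative real part. In particular, there is no R-tipping away from $X_-$: there is no $r>0$ for which a pullback attractor to $X_-$ fails to endpoint track the path. -/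

import Mathlib

open Set Filter Topology

/-- A parameter shift from `lm` to `lp`: a `C²` function with values in the open interval
`(lm, lp)`, with limits `lm`, `lp` and with derivative tending to `0` at `∓∞`. -/
structure IsParameterShift (Λ : ℝ → ℝ) (lm lp : ℝ) : Prop where
  contDiff : ContDiff ℝ 2 Λ
  mem_Ioo : ∀ s, Λ s ∈ Ioo lm lp
  tendsto_atBot : Tendsto Λ atBot (𝓝 lm)
  tendsto_atTop : Tendsto Λ atTop (𝓝 lp)
  deriv_atBot : Tendsto (deriv Λ) atBot (𝓝 0)
  deriv_atTop : Tendsto (deriv Λ) atTop (𝓝 0)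

/-- `x` is a solution of `x' = g x` in `U`, defined for all times `t ≥ 0`. -/
def IsForwardSolution {E : Type*} [NormedAddCommGroup E] [NormedSpace ℝ E]
    (g : E → E) (U : Set E) (x : ℝ → E) : Prop :=
  ∀ t, 0 ≤ t → x t ∈ U ∧ HasDerivWithinAt x (g (x t)) (Ici 0) t

/-- The basin of attraction of `p` for the system `x' = g x` in `U`: the initial values whose
solution exists in `U` for all `t ≥ 0` and converges to `p`. -/
def basin {E : Type*} [NormedAddCommGroup E] [NormedSpace ℝ E]
    (g : E → E) (U : Set E) (p : E) : Set E :=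
  {y | ∃ x : ℝ → E, x 0 = y ∧ IsForwardSolution g U x ∧ Tendsto x atTop (𝓝 p)}

/-- `p` is an attracting equilibrium of `x' = g x` in `U`: an equilibrium that is Lyapunov stable
and whose basin of attraction is a neighbourhood of it. -/
structure IsAttractingEquilibrium {E : Type*} [NormedAddCommGroup E] [NormedSpace ℝ E]
    (g : E → E) (U : Set E) (p : E) : Prop where
  mem : p ∈ U
  eq_zero : g p = 0
  stable : ∀ ε > 0, ∃ δ > 0, ∀ x : ℝ → E, IsForwardSolution g U x → dist (x 0) p < δ →
    ∀ t, 0 ≤ t → dist (x t) p < ε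
  attracting : basin g U p ∈ 𝓝 p

/-- All (complex) eigenvalues of the derivative of `g` at `p` have negative real part. -/
def IsLinearlyStable {n : ℕ} (g : EuclideanSpace ℝ (Fin n) → EuclideanSpace ℝ (Fin n))
    (p : EuclideanSpace ℝ (Fin n)) : Prop :=
  ∀ μ : ℂ, Polynomial.aeval μ
    (LinearMap.charpoly
      (fderiv ℝ g p : EuclideanSpace ℝ (Fin n) →ₗ[ℝ] EuclideanSpace ℝ (Fin n))) = 0 →
    μ.re < 0

/-- `(X(s), Λ(s))` is a stable path of `x' = f(x, λ)` in `U` with limits `Xm`, `Xp`: for every `s`,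
and also in the limits `s → ∓∞`, it consists of attracting equilibria. -/
structure IsStablePath {E : Type*} [NormedAddCommGroup E] [NormedSpace ℝ E]
    (f : E → ℝ → E) (U : Set E) (Λ : ℝ → ℝ) (lm lp : ℝ) (X : ℝ → E) (Xm Xp : E) : Prop where
  attracting : ∀ s, IsAttractingEquilibrium (fun x => f x (Λ s)) U (X s)
  tendsto_atBot : Tendsto X atBot (𝓝 Xm)
  tendsto_atTop : Tendsto X atTop (𝓝 Xp)
  attracting_minus : IsAttractingEquilibrium (fun x => f x lm) U Xm
  attracting_plus : IsAttractingEquilibrium (fun x => f x lp) U Xp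

/-- The vector `v`, attached at `x`, points strictly into `K`: moving from `x` a short time in the
direction `v` leads into the interior of `K`. -/
def PointsStrictlyInto {E : Type*} [NormedAddCommGroup E] [NormedSpace ℝ E]
    (v x : E) (K : Set E) : Prop :=
  ∃ ε > 0, ∀ h : ℝ, 0 < h → h < ε → x + h • v ∈ interior K

/-- Forward inflowing stability of the path `(X(s), Λ(s))` with limits `Xm`, `Xp`. -/
def IsForwardInflowingStable {E : Type*} [NormedAddCommGroup E] [NormedSpace ℝ E]
    (f : E → ℝ → E) (U : Set E) (Λ : ℝ → ℝ) (lp : ℝ) (X : ℝ → E) (Xm Xp : E) : Prop :=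
  ∃ K : ℝ → Set E,
    (∀ s, IsCompact (K s)) ∧
    (∀ s, X s ∈ interior (K s)) ∧
    (∀ s₁ s₂, s₁ < s₂ → K s₁ ⊆ K s₂) ∧
    (∀ s, ∀ x ∈ frontier (K s), PointsStrictlyInto (f x (Λ s)) x (K s)) ∧
    Xm ∈ interior (⋂ s, K s) ∧
    Xp ∈ interior (closure (⋃ s, K s)) ∧
    IsCompact (closure (⋃ s, K s)) ∧
    closure (⋃ s, K s) ⊆ basin (fun x => f x lp) U Xp

/-- `x` solves `x' = f(x, Λ(r t))` in `U` on the time interval `(-∞, b)`, `b ≤ ∞`, and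
`x(t) → Xm` as `t → -∞`. Values of `x` outside `(-∞, b)` are irrelevant. -/
structure IsPullbackSolution {E : Type*} [NormedAddCommGroup E] [NormedSpace ℝ E]
    (f : E → ℝ → E) (U : Set E) (Λ : ℝ → ℝ) (r : ℝ) (Xm : E) (b : EReal) (x : ℝ → E) : Prop where
  bot_lt : ⊥ < b
  solution : ∀ t : ℝ, (t : EReal) < b → x t ∈ U ∧ HasDerivAt x (f (x t) (Λ (r * t))) t
  tendsto_atBot : Tendsto x atBot (𝓝 Xm)

/-- `x`, on `(-∞, b)`, is a (local) pullback attractor to `Xm` for the rate `r`: a trajectory that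
converges to `Xm` as `t → -∞`, on its maximal interval of existence. -/
structure IsPullbackAttractor {E : Type*} [NormedAddCommGroup E] [NormedSpace ℝ E]
    (f : E → ℝ → E) (U : Set E) (Λ : ℝ → ℝ) (r : ℝ) (Xm : E) (b : EReal) (x : ℝ → E) : Prop
    extends IsPullbackSolution f U Λ r Xm b x where
  maximal : ∀ (b' : EReal) (y : ℝ → E), IsPullbackSolution f U Λ r Xm b' y →
    (∀ t : ℝ, (t : EReal) < b → (t : EReal) < b' → y t = x t) → b' ≤ b

/-- The trajectory `x` on `(-∞, b)` endpoint tracks a path with limit `Xp` at `+∞`: it exists for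
all times and converges to `Xp`. -/
def EndpointTracks {E : Type*} [TopologicalSpace E] (Xp : E) (b : EReal) (x : ℝ → E) : Prop :=
  b = ⊤ ∧ Tendsto x atTop (𝓝 Xp)

/-- There is R-tipping away from `Xm`: for some rate `r > 0` a pullback attractor to `Xm` does not
endpoint track the path. -/
def HasRTipping {E : Type*} [NormedAddCommGroup E] [NormedSpace ℝ E]
    (f : E → ℝ → E) (U : Set E) (Λ : ℝ → ℝ) (Xm Xp : E) : Prop :=
  ∃ r : ℝ, r > 0 ∧ ∃ (b : EReal) (x : ℝ → E), IsPullbackAttractor f U Λ r Xm b x ∧ ¬ EndpointTracks Xp b x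

/-! Near the compact set `K₊ × [lm, lp]` the field `f` is replaced by a bounded, globally Lipschitz
field `h`, all of whose solutions are global. The sets `K (r t)` are closed, grow with `t`, and the
field points into them, so they form a forward invariant trap
(`IsIntegralCurve.mem_of_forall_eventually_mem`). Since `Xm` is interior to `⋂ s, K s`, every
solution emanating from `Xm` is caught at an early time and stays in `K₊`, where `h = f`. It is
therefore a solution for `f`, and no blow-up or exit from `U` can occur.

Tracking: `K₊` is a compact part of the basin of the stable equilibrium `Xp`, hence is attracted
uniformly in some time `T`. At late times the equation differs little from its limit over a window
of length `T`, so the trapped solution ends each such window close to `Xp`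
(`IsIntegralCurve.tendsto_of_uniform_attraction`).

Existence: solutions started at `Xm` at time `-n` remain near `Xm` up to a time independent of `n`.
A limit of a subsequence is the pullback attractor (`exists_isIntegralCurve_tendsto_atBot`).

Uniqueness: the difference `w` of two pullback attractors satisfies `w' = A w + o(‖w‖)` as `t → -∞`.
If `A` is Hurwitz, a nonzero `w` would grow exponentially backwards in time, whereas `w` is bounded
there (`exists_forall_eq_zero_of_bounded_atBot`). -/

/-! ### Global solutions of Lipschitz equations and invariance of growing sets -/

section GlobalODE

variable {E : Type*} [NormedAddCommGroup E] [NormedSpace ℝ E] {v : ℝ → E → E} {K : NNReal}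

theorem IsIntegralCurve.eq_of_lipschitzWith {y z : ℝ → E} (hv : ∀ t, LipschitzWith K (v t))
    (hy : IsIntegralCurve y v) (hz : IsIntegralCurve z v) {a : ℝ} (h : y a = z a) : y = z :=
  ODE_solution_unique_univ (s := fun _ => univ) (fun t => (hv t).lipschitzOnWith)
    (fun t => ⟨hy t, mem_univ _⟩) (fun t => ⟨hz t, mem_univ _⟩) h

/-- A bounded, globally Lipschitz time-dependent vector field has global integral curves. -/
theorem exists_isIntegralCurve_of_bounded [CompleteSpace E] (hv : ∀ t, LipschitzWith K (v t))
    (hc : ∀ x, Continuous fun t => v t x) {C : NNReal} (hb : ∀ t x, ‖v t x‖ ≤ C) (a : ℝ) (x₀ : E) :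
    ∃ y : ℝ → E, y a = x₀ ∧ IsIntegralCurve y v := by
  have key : ∀ n : ℕ, ∃ α : ℝ → E, α a = x₀ ∧
      ∀ t ∈ Ioo (a - (n + 1)) (a + (n + 1)), HasDerivAt α (v t (α t)) t := by
    intro n
    have hn : (0 : ℝ) < n + 1 := by positivity
    have hP : IsPicardLindelof v (tmin := a - (n + 1)) (tmax := a + (n + 1))
        ⟨a, by constructor <;> linarith⟩ x₀ (C * (n + 1)) 0 C K :=
      { lipschitzOnWith := fun t _ => (hv t).lipschitzOnWith
        continuousOn := fun x _ => (hc x).continuousOn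
        norm_le := fun t _ x _ => hb t x
        mul_max_le := by simp }
    obtain ⟨α, h0, h⟩ := hP.exists_eq_forall_mem_Icc_hasDerivWithinAt₀
    exact ⟨α, h0, fun t ht => (h t (Ioo_subset_Icc_self ht)).hasDerivAt (Icc_mem_nhds ht.1 ht.2)⟩
  choose α h0 hα using key
  have hEq : ∀ n m : ℕ, n ≤ m → EqOn (α n) (α m) (Ioo (a - (n + 1)) (a + (n + 1))) := by
    intro n m hnm
    have hnm' : (n : ℝ) ≤ m := by exact_mod_cast hnm
    have hn : (0 : ℝ) < n + 1 := by positivity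
    refine ODE_solution_unique_of_mem_Ioo (s := fun _ => univ) (v := v) (K := K) (t₀ := a)
      (fun t _ => (hv t).lipschitzOnWith) ⟨by linarith, by linarith⟩
      (fun t ht => ⟨hα n t ht, mem_univ _⟩) (fun t ht => ⟨hα m t ?_, mem_univ _⟩)
      ((h0 n).trans (h0 m).symm)
    exact ⟨by linarith [ht.1], by linarith [ht.2]⟩
  -- At time `t` the local solution of index `⌈|t - a|⌉₊` is used; the extra `1` in the radius keeps
  -- `t` inside its open interval.
  refine ⟨fun t => α ⌈|t - a|⌉₊ t, h0 _, fun t => ?_⟩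
  set N := ⌈|t - a|⌉₊ with hN
  have hmem : ∀ s : ℝ, s ∈ Ioo (a - (⌈|s - a|⌉₊ + 1 : ℝ)) (a + (⌈|s - a|⌉₊ + 1)) := by
    intro s
    have := Nat.le_ceil (|s - a|)
    have := abs_le.1 this
    constructor <;> linarith
  have ht := hmem t
  have hev : (fun t => α ⌈|t - a|⌉₊ t) =ᶠ[𝓝 t] α N := by
    filter_upwards [isOpen_Ioo.mem_nhds ht] with s hs
    rcases le_total ⌈|s - a|⌉₊ N with h | h
    · exact hEq _ _ h (hmem s)
    · exact (hEq _ _ h hs).symm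
  exact (hα N t ht).congr_of_eventuallyEq hev

theorem IsIntegralCurve.dist_le_of_le {y z : ℝ → E} (hv : ∀ t, LipschitzWith K (v t))
    (hy : IsIntegralCurve y v) (hz : IsIntegralCurve z v) {s t : ℝ} (h : s ≤ t) :
    dist (y t) (z t) ≤ dist (y s) (z s) * Real.exp (K * (t - s)) :=
  dist_le_of_trajectories_ODE hv hy.continuous.continuousOn (fun t _ => (hy t).hasDerivWithinAt)
    hz.continuous.continuousOn (fun t _ => (hz t).hasDerivWithinAt) le_rfl t ⟨h, le_rfl⟩

theorem IsIntegralCurve.dist_le {y z : ℝ → E} (hv : ∀ t, LipschitzWith K (v t))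
    (hy : IsIntegralCurve y v) (hz : IsIntegralCurve z v) (s t : ℝ) :
    dist (y t) (z t) ≤ dist (y s) (z s) * Real.exp (K * |t - s|) := by
  rcases le_total s t with h | h
  · rw [abs_of_nonneg (sub_nonneg.2 h)]
    exact hy.dist_le_of_le hv hz h
  · have rev : ∀ {x : ℝ → E}, IsIntegralCurve x v →
        IsIntegralCurve (fun τ => x (-τ)) (fun τ p => -v (-τ) p) := by
      intro x hx τ
      simpa [Function.comp_def] using (hx (-τ)).scomp τ (hasDerivAt_neg τ)
    have := (rev hy).dist_le_of_le (K := K) (fun t => (hv (-t)).neg) (rev hz) (neg_le_neg h)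
    simp only [neg_neg] at this
    rw [abs_of_nonpos (sub_nonpos.2 h)]
    convert this using 4
    ring

/-- Viability: a growing family of closed sets `C t` is invariant under `y' = v t y` if at each of
its points the field `v t` points, for a short time, into `C t`. -/
theorem IsIntegralCurve.mem_of_forall_eventually_mem [ProperSpace E] {y : ℝ → E}
    (hv : ∀ t, LipschitzWith K (v t)) (hy : IsIntegralCurve y v) {C : ℝ → Set E}
    (hC : ∀ t, IsClosed (C t)) (hmono : Monotone C)
    (hin : ∀ t, ∀ x ∈ C t, ∀ᶠ h in 𝓝[>] (0 : ℝ), x + h • v t x ∈ C t)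
    {a : ℝ} (ha : y a ∈ C a) {b : ℝ} (hab : a ≤ b) : y b ∈ C b := by
  have hne : ∀ t, a ≤ t → (C t).Nonempty := fun t ht => ⟨y a, hmono ht ha⟩
  -- In the rate `K + 1`, `K` pays for replacing `y t` by a nearest point of `C t`, and `1` for the
  -- remainder in the derivative of `y`. Finally `ε → 0`.
  have key : ∀ ε : ℝ, 0 < ε →
      Metric.infDist (y b) (C b) ≤ ε * Real.exp ((K + 1) * (b - a)) := by
    intro ε hε
    set B : ℝ → ℝ := fun t => ε * Real.exp ((K + 1) * (t - a)) with hB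
    have hBc : Continuous B := by fun_prop
    have hBpos : ∀ t, 0 < B t := fun t => by positivity
    let S : Set ℝ := {t | ∀ s ∈ Icc a t, Metric.infDist (y s) (C s) ≤ B s}
    suffices h : Icc a b ⊆ S from h ⟨hab, le_rfl⟩ b ⟨hab, le_rfl⟩
    refine IsClosed.Icc_subset_of_forall_exists_gt ?_ ?_ ?_
    · refine isClosed_of_closure_subset fun t ht => ?_
      have htI : t ∈ Icc a b :=
        closure_minimal inter_subset_right isClosed_Icc ht
      refine ⟨fun s hs => ?_, htI⟩
      have hlt : ∀ s, a ≤ s → s < t → Metric.infDist (y s) (C s) ≤ B s := by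
        intro s has hst
        obtain ⟨u, hu, huS⟩ := mem_closure_iff.1 ht (Ioi s) isOpen_Ioi hst
        exact huS.1 s ⟨has, le_of_lt hu⟩
      rcases hs.2.lt_or_eq with hst | rfl
      · exact hlt s hs.1 hst
      -- Growth of `C` lets the bound pass to the limit from the left: the distance to `C s` is at
      -- most the distance to `C u` for `u < s`.
      rcases hs.1.lt_or_eq with has | rfl
      · have h1 : Tendsto (fun u => Metric.infDist (y u) (C s)) (𝓝[<] s)
            (𝓝 (Metric.infDist (y s) (C s))) :=
          (((Metric.continuous_infDist_pt _).comp hy.continuous).tendsto s).mono_left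
            nhdsWithin_le_nhds
        have h2 : Tendsto B (𝓝[<] s) (𝓝 (B s)) := (hBc.tendsto s).mono_left nhdsWithin_le_nhds
        refine le_of_tendsto_of_tendsto h1 h2 ?_
        filter_upwards [Ioo_mem_nhdsLT has] with u hu
        exact (Metric.infDist_le_infDist_of_subset (hmono hu.2.le) (hne u hu.1.le)).trans
          (hlt u hu.1.le hu.2)
      · rw [Metric.infDist_zero_of_mem ha]; exact (hBpos _).le
    · intro s hs
      obtain rfl : s = a := le_antisymm hs.2 hs.1
      rw [Metric.infDist_zero_of_mem ha]; exact (hBpos _).le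
    · rintro t ⟨htS, hat, htb⟩ u (hu : t < u)
      -- A short Euler step from the nearest point `p` stays in `C t ⊆ C s`, so its distance to `y
      -- s` bounds the distance from `y s` to `C s`.
      obtain ⟨p, hp, hpd⟩ := (hC t).exists_infDist_eq_dist (hne t hat) (y t)
      have hd : dist (y t) p ≤ B t := hpd ▸ htS t ⟨hat, le_rfl⟩
      have hev1 : ∀ᶠ s in 𝓝[>] t, p + (s - t) • v t p ∈ C t := by
        have hsub : Tendsto (fun s : ℝ => s - t) (𝓝[>] t) (𝓝[>] 0) := by
          refine tendsto_nhdsWithin_iff.2 ⟨?_, ?_⟩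
          · have : Tendsto (fun s : ℝ => s - t) (𝓝 t) (𝓝 (t - t)) :=
              (continuous_id.sub continuous_const).tendsto t
            rw [sub_self] at this
            exact this.mono_left nhdsWithin_le_nhds
          · filter_upwards [self_mem_nhdsWithin] with s (hs : t < s)
            exact sub_pos.2 hs
        exact hsub.eventually (hin t p hp)
      have hev2 : ∀ᶠ s in 𝓝[>] t, ‖y s - y t - (s - t) • v t (y t)‖ ≤ B t * ‖s - t‖ :=
        ((hasDerivAt_iff_isLittleO.1 (hy t)).def (hBpos t)).filter_mono nhdsWithin_le_nhds
      have hev : ∀ᶠ s in 𝓝[>] t, Metric.infDist (y s) (C s) ≤ B s := by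
        filter_upwards [hev1, hev2, self_mem_nhdsWithin] with s h1 h2 (hs : t < s)
        have hst : 0 < s - t := sub_pos.2 hs
        rw [Real.norm_of_nonneg hst.le] at h2
        have hLip : ‖v t (y t) - v t p‖ ≤ K * B t := by
          rw [← dist_eq_norm]
          exact ((hv t).dist_le_mul _ _).trans (by gcongr)
        calc Metric.infDist (y s) (C s)
            ≤ dist (y s) (p + (s - t) • v t p) := Metric.infDist_le_dist_of_mem (hmono hs.le h1)
          _ = ‖(y s - y t - (s - t) • v t (y t)) + (y t - p) +
                (s - t) • (v t (y t) - v t p)‖ := by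
              rw [dist_eq_norm]; congr 1; module
          _ ≤ B t * (s - t) + B t + (s - t) * (K * B t) := by
              refine (norm_add₃_le ..).trans ?_
              rw [norm_smul, Real.norm_of_nonneg hst.le, ← dist_eq_norm (y t) p]
              gcongr
          _ = B t * ((K + 1) * (s - t) + 1) := by ring
          _ ≤ B t * Real.exp ((K + 1) * (s - t)) := by
              gcongr
              exact Real.add_one_le_exp _
          _ = B s := by
              simp only [hB]
              rw [mul_assoc, ← Real.exp_add]
              congr 2
              ring
      obtain ⟨c, hc, hcS⟩ := (mem_nhdsGT_iff_exists_Ioc_subset).1 hev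
      refine ⟨min c u, fun s hs => ?_, lt_min hc hu, min_le_right _ _⟩
      rcases le_or_gt s t with h | h
      · exact htS s ⟨hs.1, h⟩
      · exact hcS ⟨h, hs.2.trans (min_le_left _ _)⟩
  have h0 : Metric.infDist (y b) (C b) = 0 := by
    refine le_antisymm (le_of_forall_gt_imp_ge_of_dense fun δ hδ => ?_) Metric.infDist_nonneg
    have := key (δ / Real.exp ((K + 1) * (b - a))) (by positivity)
    rwa [div_mul_cancel₀ _ (Real.exp_pos _).ne'] at this
  exact ((hC b).mem_iff_infDist_zero (hne b hab)).2 h0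

end GlobalODE

/-! ### Uniform attraction of compact sets -/

section Autonomous

variable {E : Type*} [NormedAddCommGroup E] [NormedSpace ℝ E] {g : E → E} {K : NNReal}

theorem IsIntegralCurve.comp_add_autonomous {y : ℝ → E} (hy : IsIntegralCurve y fun _ => g)
    (s : ℝ) : IsIntegralCurve (fun t => y (t + s)) fun _ => g :=
  hy.comp_add s

/-- A stable equilibrium attracts compact subsets of its basin uniformly. -/
theorem IsCompact.exists_forall_dist_lt_of_stable (hg : LipschitzWith K g)
    (hex : ∀ x, ∃ y : ℝ → E, y 0 = x ∧ IsIntegralCurve y fun _ => g) {p : E}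
    (hstab : ∀ ε > 0, ∃ δ > 0, ∀ y : ℝ → E, IsIntegralCurve y (fun _ => g) → dist (y 0) p < δ →
      ∀ t, 0 ≤ t → dist (y t) p < ε)
    {C : Set E} (hC : IsCompact C)
    (hatt : ∀ y : ℝ → E, IsIntegralCurve y (fun _ => g) → y 0 ∈ C → Tendsto y atTop (𝓝 p))
    {ε : ℝ} (hε : 0 < ε) :
    ∃ T > 0, ∀ y : ℝ → E, IsIntegralCurve y (fun _ => g) → y 0 ∈ C →
      ∀ t, T ≤ t → dist (y t) p < ε := by
  obtain ⟨δ, hδ, hδε⟩ := hstab ε hε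
  refine hC.induction_on (p := fun S => ∃ T > 0, ∀ y : ℝ → E, IsIntegralCurve y (fun _ => g) →
    y 0 ∈ S → ∀ t, T ≤ t → dist (y t) p < ε) ?_ ?_ ?_ ?_
  · exact ⟨1, one_pos, fun y _ h => h.elim⟩
  · rintro s t hst ⟨T, hT, h⟩
    exact ⟨T, hT, fun y hy h0 => h y hy (hst h0)⟩
  · rintro s t ⟨T, hT, h⟩ ⟨T', hT', h'⟩
    refine ⟨max T T', lt_max_of_lt_left hT, fun y hy h0 τ hτ => ?_⟩
    rcases h0 with h0 | h0
    · exact h y hy h0 τ ((le_max_left _ _).trans hτ)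
    · exact h' y hy h0 τ ((le_max_right _ _).trans hτ)
  · intro x hx
    obtain ⟨z, rfl, hz⟩ := hex x
    have hev := (Metric.tendsto_nhds.1 (hatt z hz hx) (δ / 2) (half_pos hδ)).and
      (eventually_gt_atTop 0)
    obtain ⟨T, hTz, hT⟩ := hev.exists
    -- Distances grow by at most `exp (K * T)` up to time `T`, so a start in this ball is still
    -- within `δ / 2` of `z T`, hence within `δ` of `p`; stability takes over from there.
    have hr : 0 < δ / 2 * Real.exp (-(K * T)) := by positivity
    refine ⟨Metric.ball (z 0) (δ / 2 * Real.exp (-(K * T))),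
      mem_nhdsWithin_of_mem_nhds (Metric.ball_mem_nhds _ hr), T, hT, fun y hy h0 t ht => ?_⟩
    have hd : dist (y T) p < δ := by
      have h1 := hy.dist_le_of_le (fun _ => hg) hz hT.le
      have h2 : dist (y 0) (z 0) * Real.exp (K * (T - 0)) < δ / 2 := by
        calc _ < δ / 2 * Real.exp (-(K * T)) * Real.exp (K * (T - 0)) := by
              gcongr; exact h0
          _ = δ / 2 := by rw [mul_assoc, ← Real.exp_add]; simp
      linarith [dist_triangle (y T) (z T) p]
    have := hδε _ (hy.comp_add_autonomous T) (by simpa using hd) (t - T) (sub_nonneg.2 ht)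
    simpa using this

end Autonomous

/-! ### Dependence on the parameter and asymptotically autonomous equations -/

section Parameter

theorem LipschitzWith.curry_left {E : Type*} [NormedAddCommGroup E] {h : E → ℝ → E} {L : NNReal}
    (hL : LipschitzWith L (Function.uncurry h)) (l : ℝ) :
    LipschitzWith L fun x => h x l := by
  simpa [Function.comp_def] using hL.comp (LipschitzWith.prodMk_right l)

theorem LipschitzWith.curry_right {E : Type*} [NormedAddCommGroup E] {h : E → ℝ → E} {L : NNReal}
    (hL : LipschitzWith L (Function.uncurry h)) (x : E) :
    LipschitzWith L (h x) := by
  simpa [Function.comp_def] using hL.comp (LipschitzWith.prodMk_left x)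

variable {E : Type*} [NormedAddCommGroup E] [NormedSpace ℝ E] {h : E → ℝ → E} {L : NNReal}

theorem exists_isIntegralCurve_parameter [CompleteSpace E]
    (hL : LipschitzWith L (Function.uncurry h)) {C : NNReal} (hb : ∀ x l, ‖h x l‖ ≤ C)
    {μ : ℝ → ℝ} (hμ : Continuous μ) (a : ℝ) (x₀ : E) :
    ∃ y : ℝ → E, y a = x₀ ∧ IsIntegralCurve y fun t x => h x (μ t) :=
  exists_isIntegralCurve_of_bounded (fun t => hL.curry_left (μ t))
    (fun x => (hL.curry_right x).continuous.comp hμ) (fun t x => hb x (μ t)) a x₀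

/-- Over bounded time spans, solutions depend continuously on the parameter function. -/
theorem exists_forall_dist_le_of_parameter_close (hL : LipschitzWith L (Function.uncurry h))
    (T : ℝ) {ε : ℝ} (hε : 0 < ε) :
    ∃ η > 0, ∀ (μ ν : ℝ → ℝ) (y z : ℝ → E) (a b : ℝ), b ≤ a + T →
      IsIntegralCurve y (fun t x => h x (μ t)) → IsIntegralCurve z (fun t x => h x (ν t)) →
      y a = z a → (∀ t ∈ Icc a b, |μ t - ν t| ≤ η) → ∀ t ∈ Icc a b, dist (y t) (z t) ≤ ε := by
  have hcont : Tendsto (fun η : ℝ => gronwallBound 0 L (L * η) T) (𝓝 0) (𝓝 0) := by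
    have := ((gronwallBound_continuous_ε 0 L T).comp
      (continuous_const.mul continuous_id : Continuous fun η : ℝ => (L : ℝ) * η)).tendsto 0
    simpa [Function.comp_def, gronwallBound_ε0_δ0] using this
  have hev : ∀ᶠ η in 𝓝[>] (0 : ℝ), gronwallBound 0 L (L * η) T < ε ∧ 0 < η :=
    ((hcont.mono_left nhdsWithin_le_nhds).eventually_lt_const hε).and self_mem_nhdsWithin
  obtain ⟨η, hηε, hη⟩ := hev.exists
  refine ⟨η, hη, fun μ ν y z a b hb hy hz h0 hμν t ht => ?_⟩
  have := dist_le_of_approx_trajectories_ODE (δ := 0) (εf := L * η) (εg := 0)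
    (fun t => hL.curry_left (ν t)) hy.continuous.continuousOn
    (fun t (_ : t ∈ Ico a b) => (hy t).hasDerivWithinAt)
    (fun t ht => ?_) hz.continuous.continuousOn (fun t _ => (hz t).hasDerivWithinAt)
    (fun t _ => (dist_self _).le) (by simp [h0]) t ht
  · rw [add_zero] at this
    refine this.trans (le_trans ?_ hηε.le)
    exact gronwallBound_mono le_rfl (by positivity) L.2 (by linarith [ht.2])
  · refine ((hL.curry_right (y t)).dist_le_mul _ _).trans ?_
    rw [Real.dist_eq]
    gcongr
    exact hμν t (Ico_subset_Icc_self ht)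

/-- An asymptotically autonomous solution that stays in a set which is uniformly attracted by `p`
under the limiting equation converges to `p`. -/
theorem IsIntegralCurve.tendsto_of_uniform_attraction [CompleteSpace E]
    (hL : LipschitzWith L (Function.uncurry h)) {C : NNReal} (hb : ∀ x l, ‖h x l‖ ≤ C)
    {μ : ℝ → ℝ} {l : ℝ} (hμ : Tendsto μ atTop (𝓝 l)) {P : Set E} {p : E}
    (hP : ∀ ε > 0, ∃ T > 0, ∀ y : ℝ → E, IsIntegralCurve y (fun _ x => h x l) → y 0 ∈ P →
      ∀ t, T ≤ t → dist (y t) p < ε)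
    {y : ℝ → E} (hy : IsIntegralCurve y fun t x => h x (μ t)) {a : ℝ} (hyP : ∀ t, a ≤ t → y t ∈ P) :
    Tendsto y atTop (𝓝 p) := by
  refine Metric.tendsto_nhds.2 fun ε hε => ?_
  obtain ⟨T, hT, hTP⟩ := hP (ε / 2) (half_pos hε)
  obtain ⟨η, hη, hcomp⟩ := exists_forall_dist_le_of_parameter_close hL T (half_pos hε)
  obtain ⟨τ, hτ⟩ := eventually_atTop.1 (Metric.tendsto_nhds.1 hμ η hη)
  filter_upwards [eventually_ge_atTop (max τ a + T)] with t ht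
  have hτt : τ ≤ t - T := by linarith [le_max_left τ a]
  have hat : a ≤ t - T := by linarith [le_max_right τ a]
  -- Comparison with the limiting equation restarted at `t - T`: one window of length `T` suffices
  -- for attraction, and the error over it does not depend on `t`.
  obtain ⟨z, hz0, hz⟩ := exists_isIntegralCurve_parameter hL hb
    (continuous_const : Continuous fun _ : ℝ => l) (t - T) (y (t - T))
  have h1 := hcomp μ (fun _ => l) y z (t - T) t (by linarith) hy hz hz0.symm
    (fun s hs => (hτ s (hτt.trans hs.1)).le) t ⟨by linarith, le_rfl⟩
  have h2 := hTP _ (hz.comp_add_autonomous (t - T)) (by simpa [hz0] using hyP _ hat) T le_rfl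
  rw [add_sub_cancel] at h2
  linarith [dist_triangle (y t) (z t) p]

/-- If `p` is asymptotically stable for the limiting equation at `-∞`, then solutions started at
`p` stay close to `p` up to a time that does not depend on the starting time. -/
theorem exists_forall_dist_le_of_start_at [ProperSpace E]
    (hL : LipschitzWith L (Function.uncurry h)) {C : NNReal} (hb : ∀ x l, ‖h x l‖ ≤ C)
    {μ : ℝ → ℝ} {l : ℝ} (hμ : Tendsto μ atBot (𝓝 l)) {p : E}
    (hstab : ∀ ε > 0, ∃ δ > 0, ∀ y : ℝ → E, IsIntegralCurve y (fun _ x => h x l) →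
      dist (y 0) p < δ → (∀ t, 0 ≤ t → dist (y t) p < ε) ∧ Tendsto y atTop (𝓝 p))
    {ε : ℝ} (hε : 0 < ε) :
    ∃ τ : ℝ, ∀ (y : ℝ → E) (a : ℝ), IsIntegralCurve y (fun t x => h x (μ t)) → y a = p →
      ∀ t, a ≤ t → t ≤ τ → dist (y t) p ≤ ε := by
  obtain ⟨δ, hδ, hδε⟩ := hstab (ε / 2) (half_pos hε)
  have hex : ∀ x, ∃ y : ℝ → E, y 0 = x ∧ IsIntegralCurve y fun _ x => h x l :=
    fun x => exists_isIntegralCurve_parameter hL hb continuous_const 0 x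
  -- In time `T` the limiting flow maps the `δ / 2`-ball into the `δ / 4`-ball. With a parameter
  -- error of at most `δ / 4` per window, solutions return to the `δ / 2`-ball after each window, so
  -- errors do not accumulate.
  obtain ⟨T, hT, hTu⟩ := (isCompact_closedBall p (δ / 2)).exists_forall_dist_lt_of_stable
    (hL.curry_left l) hex
    (fun ε hε => (hstab ε hε).imp fun δ h => ⟨h.1, fun y hy h0 => (h.2 y hy h0).1⟩)
    (fun y hy h0 => (hδε y hy (lt_of_le_of_lt h0 (half_lt_self hδ))).2)
    (show 0 < δ / 4 by positivity)
  obtain ⟨η, hη, hcomp⟩ := exists_forall_dist_le_of_parameter_close hL T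
    (show 0 < min (δ / 4) (ε / 2) by positivity)
  obtain ⟨τ, hτ⟩ := eventually_atBot.1 (Metric.tendsto_nhds.1 hμ η hη)
  refine ⟨τ, fun y a hy h0 => ?_⟩
  have step : ∀ s, dist (y s) p ≤ δ / 2 →
      (∀ t, s ≤ t → t ≤ s + T → t ≤ τ → dist (y t) p ≤ ε) ∧
      (s + T ≤ τ → dist (y (s + T)) p ≤ δ / 2) := by
    intro s hs
    obtain ⟨z, hz0, hz⟩ := exists_isIntegralCurve_parameter hL hb
      (continuous_const : Continuous fun _ : ℝ => l) s (y s)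
    have hclose : ∀ t, s ≤ t → t ≤ s + T → t ≤ τ → dist (y t) (z t) ≤ min (δ / 4) (ε / 2) :=
      fun t hst htT htτ => hcomp μ (fun _ => l) y z s t htT hy hz hz0.symm
        (fun u hu => (hτ u (hu.2.trans htτ)).le) t ⟨hst, le_rfl⟩
    have hz' := hz.comp_add_autonomous s
    have hz0' : dist (z (0 + s)) p ≤ δ / 2 := by simpa [hz0] using hs
    constructor
    · intro t hst htT htτ
      have h1 := (hclose t hst htT htτ).trans (min_le_right _ _)
      have h2 := (hδε _ hz' (lt_of_le_of_lt hz0' (half_lt_self hδ))).1 (t - s) (sub_nonneg.2 hst)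
      rw [sub_add_cancel] at h2
      linarith [dist_triangle (y t) (z t) p]
    · intro hsT
      have h1 := (hclose (s + T) (by linarith) le_rfl hsT).trans (min_le_left _ _)
      have h2 := hTu _ hz' hz0' T le_rfl
      rw [add_comm T s] at h2
      linarith [dist_triangle (y (s + T)) (z (s + T)) p]
  have hind : ∀ k : ℕ, a + k * T ≤ τ → dist (y (a + k * T)) p ≤ δ / 2 := by
    intro k
    induction k with
    | zero => intro _; simpa [h0] using (half_pos hδ).le
    | succ k ih =>
      intro hk
      have e : a + (k + 1 : ℕ) * T = a + k * T + T := by push_cast; ring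
      rw [e] at hk ⊢
      exact (step _ (ih (by linarith))).2 hk
  intro t hat htτ
  have hq : 0 ≤ (t - a) / T := div_nonneg (sub_nonneg.2 hat) hT.le
  have h1 : ⌊(t - a) / T⌋₊ * T ≤ t - a := (le_div_iff₀ hT).1 (Nat.floor_le hq)
  have h2 : t - a < (⌊(t - a) / T⌋₊ + 1) * T := (div_lt_iff₀ hT).1 (Nat.lt_floor_add_one _)
  exact (step _ (hind ⌊(t - a) / T⌋₊ (by linarith))).1 t (by linarith) (by linarith) htτ

/-- There is a solution emanating from a point that is asymptotically stable for the limiting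
equation at `-∞`. -/
theorem exists_isIntegralCurve_tendsto_atBot [ProperSpace E]
    (hL : LipschitzWith L (Function.uncurry h)) {C : NNReal} (hb : ∀ x l, ‖h x l‖ ≤ C)
    {μ : ℝ → ℝ} (hμc : Continuous μ) {l : ℝ} (hμ : Tendsto μ atBot (𝓝 l)) {p : E}
    (hstab : ∀ ε > 0, ∃ δ > 0, ∀ y : ℝ → E, IsIntegralCurve y (fun _ x => h x l) →
      dist (y 0) p < δ → (∀ t, 0 ≤ t → dist (y t) p < ε) ∧ Tendsto y atTop (𝓝 p)) :
    ∃ y : ℝ → E, IsIntegralCurve y (fun t x => h x (μ t)) ∧ Tendsto y atBot (𝓝 p) := by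
  have hnear := fun (ε : ℝ) (hε : 0 < ε) => exists_forall_dist_le_of_start_at hL hb hμ hstab hε
  choose u hu0 hu using fun n : ℕ => exists_isIntegralCurve_parameter hL hb hμc (-(n : ℝ)) p
  have hneg : Tendsto (fun n : ℕ => -(n : ℝ)) atTop atBot :=
    tendsto_neg_atTop_atBot.comp tendsto_natCast_atTop_atTop
  have hle : ∀ t : ℝ, ∀ᶠ n : ℕ in atTop, -(n : ℝ) ≤ t := fun t => hneg.eventually_le_atBot t
  obtain ⟨τ, hτ⟩ := hnear 1 one_pos
  have hball : ∃ᶠ n in atTop, u n τ ∈ Metric.closedBall p 1 :=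
    ((hle τ).mono fun n hn => hτ (u n) _ (hu n) (hu0 n) τ hn le_rfl).frequently
  -- Convergence at the single time `τ` is enough: continuous dependence on the value at `τ` gives
  -- convergence at every time.
  obtain ⟨q, -, φ, hφ, hq⟩ := (isCompact_closedBall p (1 : ℝ)).tendsto_subseq' hball
  obtain ⟨y, rfl, hy⟩ := exists_isIntegralCurve_parameter hL hb hμc τ q
  refine ⟨y, hy, ?_⟩
  have hlim : ∀ t, Tendsto (fun n => u (φ n) t) atTop (𝓝 (y t)) := by
    intro t
    refine tendsto_iff_dist_tendsto_zero.2 ?_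
    refine squeeze_zero (fun _ => dist_nonneg)
      (fun n => (hu (φ n)).dist_le (fun t => hL.curry_left (μ t)) hy τ t) ?_
    have := (tendsto_iff_dist_tendsto_zero.1 hq).mul_const (Real.exp (L * |t - τ|))
    simpa using this
  refine Metric.tendsto_nhds.2 fun ε hε => ?_
  obtain ⟨σ, hσ⟩ := hnear (ε / 2) (half_pos hε)
  filter_upwards [eventually_le_atBot σ] with t ht
  refine lt_of_le_of_lt ?_ (half_lt_self hε)
  refine le_of_tendsto ((hlim t).dist tendsto_const_nhds) ?_
  filter_upwards [hφ.tendsto_atTop.eventually (hle t)] with n hn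
  exact hσ _ _ (hu _) (hu0 _) t hn ht

end Parameter

/-! ### Passing between the field and its cut-off -/

section Localization

variable {E : Type*} [NormedAddCommGroup E] [NormedSpace ℝ E] {f h : E → ℝ → E} {L : NNReal}

/-- If `h = f` near `P ×ˢ I`, a solution for `f` coincides with the solution for `h` as long as
the latter stays in `P`. -/
theorem IsIntegralCurve.eqOn_of_eventually_eq (hL : LipschitzWith L (Function.uncurry h))
    {P : Set E} {I : Set ℝ}
    (hfh : ∀ᶠ q in 𝓝ˢ (P ×ˢ I), Function.uncurry h q = Function.uncurry f q)
    {μ : ℝ → ℝ} (hμ : Continuous μ) (hμI : ∀ t, μ t ∈ I)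
    {y z : ℝ → E} (hy : IsIntegralCurve y fun t x => h x (μ t)) {a b : ℝ}
    (hzc : ContinuousOn z (Icc a b))
    (hz : ∀ t ∈ Ico a b, HasDerivWithinAt z (f (z t) (μ t)) (Ici t) t)
    (hyP : ∀ t ∈ Ico a b, z t = y t → y t ∈ P) (h0 : z a = y a) : EqOn z y (Icc a b) := by
  rcases lt_or_ge b a with hba | hab
  · intro t ht; exact absurd (ht.1.trans ht.2) (not_le.2 hba)
  suffices hs : Icc a b ⊆ {t | z t = y t} from hs
  refine IsClosed.Icc_subset_of_forall_exists_gt ?_ h0 ?_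
  · have : {t | z t = y t} ∩ Icc a b = {t ∈ Icc a b | z t = y t} := by
      ext t; exact and_comm
    rw [this]
    exact isClosed_Icc.isClosed_eq hzc hy.continuous.continuousOn
  -- At a time of agreement `(z t, μ t)` lies in `P ×ˢ I`; hence `h = f` along `z` for a short time
  -- afterwards, and uniqueness for `h` prolongs the agreement.
  · rintro t ⟨hzy, ht⟩ u (hu : t < u)
    have htQ : (z t, μ t) ∈ P ×ˢ I := ⟨hzy ▸ hyP t ht hzy, hμI t⟩
    have hcont : Tendsto (fun s => (z s, μ s)) (𝓝[≥] t) (𝓝 (z t, μ t)) :=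
      ((hz t ht).continuousWithinAt).prodMk_nhds hμ.continuousWithinAt
    have hev : ∀ᶠ s in 𝓝[≥] t, h (z s) (μ s) = f (z s) (μ s) :=
      hcont.eventually (hfh.filter_mono (nhds_le_nhdsSet htQ))
    obtain ⟨c, hc, hcS⟩ := (mem_nhdsGE_iff_exists_Icc_subset).1 hev
    set d := min c (min u b) with hd
    have htd : t < d := lt_min hc (lt_min hu ht.2)
    have hdb : d ≤ b := (min_le_right _ _).trans (min_le_right _ _)
    have heq : EqOn z y (Icc t d) := by
      refine ODE_solution_unique (v := fun t x => h x (μ t)) (fun t => hL.curry_left (μ t))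
        (hzc.mono (Icc_subset_Icc ht.1 hdb)) (fun s hs => ?_)
        hy.continuous.continuousOn (fun s _ => (hy s).hasDerivWithinAt) hzy
      have e : h (z s) (μ s) = f (z s) (μ s) := hcS ⟨hs.1, hs.2.le.trans (min_le_left _ _)⟩
      rw [e]
      exact hz s ⟨ht.1.trans hs.1, hs.2.trans_le hdb⟩
    exact ⟨d, heq ⟨htd.le, le_rfl⟩, htd, (min_le_right _ _).trans (min_le_left _ _)⟩

theorem IsForwardSolution.continuousOn {g : E → E} {U : Set E} {z : ℝ → E}
    (hz : IsForwardSolution g U z) : ContinuousOn z (Ici 0) :=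
  fun t ht => (hz t ht).2.continuousWithinAt

theorem IsForwardSolution.eqOn_integralCurve (hL : LipschitzWith L (Function.uncurry h))
    {P : Set E} {I : Set ℝ}
    (hfh : ∀ᶠ q in 𝓝ˢ (P ×ˢ I), Function.uncurry h q = Function.uncurry f q) {l : ℝ} (hl : l ∈ I)
    {U : Set E} {y z : ℝ → E} (hz : IsForwardSolution (fun x => f x l) U z)
    (hy : IsIntegralCurve y fun _ x => h x l)
    (hP : ∀ t, 0 ≤ t → z t = y t → y t ∈ P) (h0 : z 0 = y 0) : EqOn z y (Ici 0) :=
  fun t ht => hy.eqOn_of_eventually_eq hL hfh (μ := fun _ => l) continuous_const (fun _ => hl)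
    (b := t) (hz.continuousOn.mono Icc_subset_Ici_self)
    (fun s hs => (hz s hs.1).2.mono (Ici_subset_Ici.2 hs.1)) (fun s hs => hP s hs.1) h0
    ⟨ht, le_rfl⟩

/-- Asymptotic stability only depends on the vector field near the equilibrium. -/
theorem IsAttractingEquilibrium.exists_forall_integralCurve
    (hL : LipschitzWith L (Function.uncurry h)) {P : Set E} {I : Set ℝ}
    (hfh : ∀ᶠ q in 𝓝ˢ (P ×ˢ I), Function.uncurry h q = Function.uncurry f q) {l : ℝ} (hl : l ∈ I)
    {U : Set E} {p : E} (hp : IsAttractingEquilibrium (fun x => f x l) U p) (hpP : P ∈ 𝓝 p)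
    {ε : ℝ} (hε : 0 < ε) :
    ∃ δ > 0, ∀ y : ℝ → E, IsIntegralCurve y (fun _ x => h x l) → dist (y 0) p < δ →
      (∀ t, 0 ≤ t → dist (y t) p < ε) ∧ Tendsto y atTop (𝓝 p) := by
  obtain ⟨ρ, hρ, hρP⟩ := Metric.mem_nhds_iff.1 hpP
  -- The bound `ρ` confines the solution for `f` to `P`, where both fields agree.
  obtain ⟨δ₁, hδ₁, hst⟩ := hp.stable (min ε ρ) (lt_min hε hρ)
  obtain ⟨δ₂, hδ₂, hba⟩ := Metric.mem_nhds_iff.1 hp.attracting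
  refine ⟨min δ₁ δ₂, lt_min hδ₁ hδ₂, fun y hy h0 => ?_⟩
  obtain ⟨z, hz0, hz, hzp⟩ := hba (h0.trans_le (min_le_right _ _) : y 0 ∈ Metric.ball p δ₂)
  have hzd := hst z hz (hz0.symm ▸ h0.trans_le (min_le_left _ _))
  have heq : EqOn z y (Ici 0) := hz.eqOn_integralCurve hL hfh hl hy
    (fun t ht e => e ▸ hρP ((hzd t ht).trans_le (min_le_right _ _))) hz0
  refine ⟨fun t ht => heq ht ▸ (hzd t ht).trans_le (min_le_left _ _), hzp.congr' ?_⟩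
  filter_upwards [eventually_ge_atTop 0] with t ht using heq ht

/-- A `C¹` map on an open set agrees near a compact subset with a globally Lipschitz and bounded
map. -/
theorem ContDiffOn.exists_lipschitzWith_eventuallyEq {G F : Type*} [NormedAddCommGroup G]
    [NormedSpace ℝ G] [FiniteDimensional ℝ G] [NormedAddCommGroup F] [NormedSpace ℝ F]
    {φ : G → F} {W Q : Set G} (hW : IsOpen W) (hQ : IsCompact Q) (hQW : Q ⊆ W)
    (hφ : ContDiffOn ℝ 1 φ W) :
    ∃ ψ : G → F, (∃ L, LipschitzWith L ψ) ∧ (∃ C : NNReal, ∀ x, ‖ψ x‖ ≤ C) ∧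
      ∀ᶠ x in 𝓝ˢ Q, ψ x = φ x := by
  obtain ⟨M, hM, hQM, hMW⟩ := exists_compact_between hQ hW hQW
  obtain ⟨χ, hχ1, hχ0, -⟩ := exists_contMDiffMap_one_nhds_of_subset_interior
    (modelWithCornersSelf ℝ G) (n := 1) hQ.isClosed hQM
  have hsupp : tsupport (fun x => χ x • φ x) ⊆ M := by
    refine closure_minimal (fun x hx => ?_) hM.isClosed
    by_contra hxM
    exact hx (by simp [hχ0 x hxM])
  have hcs : HasCompactSupport fun x => χ x • φ x := hM.of_isClosed_subset (isClosed_tsupport _) hsupp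
  have hχd : ContDiff ℝ 1 χ := χ.contMDiff.contDiff
  have hcd : ContDiff ℝ 1 fun x => χ x • φ x := by
    refine contDiff_iff_contDiffAt.2 fun x => ?_
    by_cases hx : x ∈ W
    · exact hχd.contDiffAt.smul (hφ.contDiffAt (hW.mem_nhds hx))
    · have : (fun x => χ x • φ x) =ᶠ[𝓝 x] fun _ => 0 :=
        notMem_tsupport_iff_eventuallyEq.1 fun h => hx (hMW (hsupp h))
      exact contDiffAt_const.congr_of_eventuallyEq this
  refine ⟨fun x => χ x • φ x, hcd.lipschitzWith_of_hasCompactSupport hcs one_ne_zero, ?_, ?_⟩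
  · obtain ⟨C, hC⟩ := hcs.exists_bound_of_continuous hcd.continuous
    exact ⟨C.toNNReal, fun x => (hC x).trans (Real.le_coe_toNNReal C)⟩
  · filter_upwards [hχ1] with x hx
    simp [hx]

end Localization

/-! ### Linear equations with Hurwitz operator and their perturbations -/

section Hurwitz

/-- With `N = B - μ`, the sum is `exp (μ t)` times the truncated exponential series of `t N`. The
only defect is the term with `N ^ (k + 1) v`, which vanishes on generalized eigenvectors for large
`k`. -/
theorem hasDerivAt_exp_mul_pow_div_factorial_smul {V : Type*} [NormedAddCommGroup V]
    [NormedSpace ℂ V] (B : Module.End ℂ V) (μ : ℂ) (v : V) (k : ℕ) (t : ℝ) :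
    HasDerivAt (fun t : ℝ => ∑ j ∈ Finset.range (k + 1),
        (Complex.exp (μ * t) * ((t : ℂ) ^ j / j.factorial)) •
          ((B - algebraMap ℂ (Module.End ℂ V) μ) ^ j) v)
      (B (∑ j ∈ Finset.range (k + 1), (Complex.exp (μ * t) * ((t : ℂ) ^ j / j.factorial)) •
          ((B - algebraMap ℂ (Module.End ℂ V) μ) ^ j) v) -
        (Complex.exp (μ * t) * ((t : ℂ) ^ k / k.factorial)) •
          ((B - algebraMap ℂ (Module.End ℂ V) μ) ^ (k + 1)) v) t := by
  set N := B - algebraMap ℂ (Module.End ℂ V) μ with hN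
  have hB : ∀ x, B x = N x + μ • x := fun x => by simp [hN]
  have hid : HasDerivAt (fun t : ℝ => (t : ℂ)) 1 t := Complex.ofRealCLM.hasDerivAt
  have hexp : HasDerivAt (fun t : ℝ => Complex.exp (μ * t)) (μ * Complex.exp (μ * t)) t := by
    simpa [mul_comm] using (hid.const_mul μ).cexp
  induction k with
  | zero =>
    have := hexp.smul_const v
    simp only [zero_add, Finset.sum_range_one, pow_zero, Nat.factorial_zero, Nat.cast_one, div_one,
      mul_one, Module.End.one_apply, pow_one]
    convert this using 1
    rw [hB, map_smul]
    module
  | succ k ih =>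
    have hpow : HasDerivAt (fun t : ℝ => (t : ℂ) ^ (k + 1) / (k + 1).factorial)
        ((t : ℂ) ^ k / k.factorial) t := by
      refine ((hid.fun_pow (k + 1)).div_const ((k + 1).factorial : ℂ)).congr_deriv ?_
      have h1 : ((k : ℂ) + 1) ≠ 0 := by exact_mod_cast Nat.succ_ne_zero k
      have h2 : (k.factorial : ℂ) ≠ 0 := by exact_mod_cast k.factorial_ne_zero
      rw [Nat.factorial_succ]
      push_cast
      simp only [mul_one]
      field_simp
    have hterm := (hexp.mul hpow).smul_const ((N ^ (k + 1)) v)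
    have hsum := ih.add hterm
    simp only [Finset.sum_range_succ _ (k + 1)]
    refine HasDerivAt.congr_deriv hsum ?_
    have hpw : N ((N ^ (k + 1)) v) = (N ^ (k + 1 + 1)) v := by
      rw [pow_succ' N (k + 1), Module.End.mul_apply]
    rw [map_add, map_smul, hB ((N ^ (k + 1)) v), hpw]
    module

theorem tendsto_exp_mul_pow_div_factorial {μ : ℂ} (hμ : μ.re < 0) (j : ℕ) :
    Tendsto (fun t : ℝ => Complex.exp (μ * t) * ((t : ℂ) ^ j / j.factorial)) atTop (𝓝 0) := by
  rw [tendsto_zero_iff_norm_tendsto_zero]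
  have h := (tendsto_rpow_mul_exp_neg_mul_atTop_nhds_zero (j : ℝ) (-μ.re)
    (neg_pos.2 hμ)).div_const (j.factorial : ℝ)
  rw [zero_div] at h
  refine h.congr' ?_
  filter_upwards [eventually_ge_atTop 0] with t ht
  rw [norm_mul, norm_div, norm_pow, Complex.norm_exp, Complex.norm_real, Real.norm_of_nonneg ht]
  simp
  ring

/-- If all eigenvalues of `B` have negative real part, every initial value has a decaying solution
of `u' = B u`. -/
theorem exists_decaying_solution_complex {V : Type*} [NormedAddCommGroup V] [NormedSpace ℂ V]
    [FiniteDimensional ℂ V] (B : Module.End ℂ V) (hB : ∀ μ, B.HasEigenvalue μ → μ.re < 0) (v : V) :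
    ∃ u : ℝ → V, u 0 = v ∧ (∀ t, HasDerivAt u (B (u t)) t) ∧ Tendsto u atTop (𝓝 0) := by
  -- Initial values of decaying solutions form a subspace, so it suffices that it contains the
  -- generalized eigenspaces, which span `V`.
  let W : Submodule ℂ V :=
    { carrier := {v | ∃ u : ℝ → V, u 0 = v ∧ (∀ t, HasDerivAt u (B (u t)) t) ∧
        Tendsto u atTop (𝓝 0)}
      zero_mem' := ⟨fun _ => 0, rfl, fun t => by simpa using hasDerivAt_const t (0 : V),
        tendsto_const_nhds⟩
      add_mem' := by
        rintro _ _ ⟨u, rfl, hu, hu0⟩ ⟨w, rfl, hw, hw0⟩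
        exact ⟨fun t => u t + w t, rfl, fun t => by simpa using (hu t).fun_add (hw t),
          by simpa using hu0.add hw0⟩
      smul_mem' := by
        rintro c _ ⟨u, rfl, hu, hu0⟩
        exact ⟨fun t => c • u t, rfl, fun t => by simpa using (hu t).fun_const_smul c,
          by simpa using hu0.const_smul c⟩ }
  suffices hW : W = ⊤ from (hW ▸ Submodule.mem_top : v ∈ W)
  rw [eq_top_iff, ← Module.End.iSup_maxGenEigenspace_eq_top B]
  refine iSup_le fun μ x hx => ?_
  obtain ⟨k, hk⟩ := (Module.End.mem_maxGenEigenspace B μ x).1 hx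
  by_cases hμ : B.HasEigenvalue μ
  · refine ⟨_, ?_, fun t => (hasDerivAt_exp_mul_pow_div_factorial_smul B μ x k t).congr_deriv ?_, ?_⟩
    · simp [Finset.sum_range_succ']
    · have : ((B - algebraMap ℂ (Module.End ℂ V) μ) ^ (k + 1)) x = 0 := by
        rw [pow_succ', Module.End.mul_apply]
        have hk' : ((B - algebraMap ℂ (Module.End ℂ V) μ) ^ k) x = 0 := by
          simpa [Algebra.algebraMap_eq_smul_one] using hk
        rw [hk', map_zero]
      rw [this, smul_zero, sub_zero]
    · rw [← Finset.sum_const_zero (s := Finset.range (k + 1))]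
      refine tendsto_finsetSum _ fun j _ => ?_
      simpa using (tendsto_exp_mul_pow_div_factorial (hB μ hμ) j).smul_const
        (((B - algebraMap ℂ (Module.End ℂ V) μ) ^ j) x)
  · have hinj : Function.Injective (B - μ • (1 : Module.End ℂ V)) := by
      rw [← LinearMap.ker_eq_bot]
      have : B.eigenspace μ = ⊥ := not_not.1 (fun h => hμ h)
      rwa [Module.End.eigenspace_def] at this
    have hx0 : x = 0 := by
      have hinjk : Function.Injective ((B - μ • (1 : Module.End ℂ V)) ^ k) := by
        rw [Module.End.coe_pow]; exact hinj.iterate k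
      exact hinjk (hk.trans (map_zero _).symm)
    exact hx0 ▸ W.zero_mem

variable {E : Type*} [NormedAddCommGroup E] [NormedSpace ℝ E] [FiniteDimensional ℝ E]

/-- In a real basis, `A` becomes a real matrix, which also acts on complex coordinates. Taking real
parts intertwines this action with `A`, so the real part of a complex decaying solution is a
decaying solution. -/
theorem exists_decaying_solution (A : E →L[ℝ] E)
    (hA : ∀ μ : ℂ, Polynomial.aeval μ (LinearMap.charpoly (A : E →ₗ[ℝ] E)) = 0 → μ.re < 0)
    (v : E) :
    ∃ u : ℝ → E, u 0 = v ∧ IsIntegralCurve u (fun _ => A) ∧ Tendsto u atTop (𝓝 0) := by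
  classical
  set b := Module.finBasis ℝ E
  set M := LinearMap.toMatrix b b (A : E →ₗ[ℝ] E) with hM
  set Mc := M.map (algebraMap ℝ ℂ) with hMc
  have hev : ∀ μ, Module.End.HasEigenvalue (Matrix.toLin' Mc) μ → μ.re < 0 := by
    intro μ hμ
    refine hA μ ?_
    rw [Module.End.hasEigenvalue_iff_isRoot_charpoly, Matrix.charpoly_toLin', hMc,
      Matrix.charpoly_map, hM, LinearMap.charpoly_toMatrix] at hμ
    rwa [Polynomial.IsRoot, Polynomial.eval_map_algebraMap] at hμ
  obtain ⟨u, hu0, hu, hut⟩ := exists_decaying_solution_complex (Matrix.toLin' Mc) hev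
    (fun i => (b.repr v i : ℂ))
  let R : (Fin (Module.finrank ℝ E) → ℂ) →L[ℝ] E :=
    ∑ i, (Complex.reCLM.comp (ContinuousLinearMap.proj i)).smulRight (b i)
  have hR : ∀ x, R x = ∑ i, (x i).re • b i := fun x => by simp [R]
  have hcomm : ∀ x, R (Matrix.toLin' Mc x) = A (R x) := by
    intro x
    have hAb : ∀ i, A (b i) = ∑ j, M j i • b j := fun i => by
      have := b.sum_repr (A (b i))
      rw [← this]
      simp [hM, LinearMap.toMatrix_apply]
    simp only [hR, map_sum, map_smul, hAb, Finset.smul_sum]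
    rw [Finset.sum_comm]
    refine Finset.sum_congr rfl fun j _ => ?_
    rw [Matrix.toLin'_apply, Matrix.mulVec, dotProduct, Complex.re_sum, Finset.sum_smul]
    refine Finset.sum_congr rfl fun i _ => ?_
    rw [smul_smul]
    congr 1
    simp [hMc, mul_comm]
  refine ⟨fun t => R (u t), ?_, fun t => ?_, ?_⟩
  · simp only [hu0, hR, Complex.ofReal_re]
    exact b.sum_repr v
  · have := R.hasFDerivAt.comp_hasDerivAt t (hu t)
    rw [hcomm] at this
    exact this
  · simpa [Function.comp_def] using (R.continuous.tendsto 0).comp hut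

/-- The flow of a Hurwitz operator is eventually a strong contraction. -/
theorem exists_forall_exists_norm_le (A : E →L[ℝ] E)
    (hA : ∀ μ : ℂ, Polynomial.aeval μ (LinearMap.charpoly (A : E →ₗ[ℝ] E)) = 0 → μ.re < 0)
    {c : ℝ} (hc : 0 < c) :
    ∃ T > 0, ∀ v, ∃ u : ℝ → E, u 0 = v ∧ IsIntegralCurve u (fun _ => A) ∧ ‖u T‖ ≤ c * ‖v‖ := by
  set b := Module.finBasis ℝ E
  choose u hu0 hu hut using fun i => exists_decaying_solution A hA (b i)
  let l := fun i => LinearMap.toContinuousLinearMap (b.coord i)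
  have hlim : Tendsto (fun t => ∑ i, ‖l i‖ * ‖u i t‖) atTop (𝓝 0) := by
    rw [← Finset.sum_const_zero (ι := Fin (Module.finrank ℝ E)) (s := Finset.univ)]
    exact tendsto_finsetSum _ fun i _ => by simpa using (hut i).norm.const_mul ‖l i‖
  obtain ⟨T, hTc, hT⟩ := ((hlim.eventually_lt_const hc).and (eventually_gt_atTop 0)).exists
  refine ⟨T, hT, fun v => ⟨fun t => ∑ i, l i v • u i t, ?_, fun t => ?_, ?_⟩⟩
  · simp only [hu0]
    exact b.sum_repr v
  · have := HasDerivAt.fun_sum (u := Finset.univ) fun i _ => (hu i t).const_smul (l i v)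
    simpa using this
  · calc ‖∑ i, l i v • u i T‖ ≤ ∑ i, ‖l i‖ * ‖u i T‖ * ‖v‖ := by
          refine norm_sum_le_of_le _ fun i _ => ?_
          rw [norm_smul, mul_right_comm]
          gcongr
          exact (l i).le_opNorm v
      _ = (∑ i, ‖l i‖ * ‖u i T‖) * ‖v‖ := by rw [Finset.sum_mul]
      _ ≤ c * ‖v‖ := by gcongr

theorem gronwallBound_zero_left_eq_mul (K ε x : ℝ) :
    gronwallBound 0 K ε x = ε * gronwallBound 0 K 1 x := by
  by_cases hK : K = 0
  · simp [gronwallBound_K0, hK]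
  · simp only [gronwallBound_of_K_ne_0 hK]
    ring

/-- A small perturbation of a linear equation with Hurwitz operator has no nonzero solution that
is bounded in backward time. -/
theorem exists_forall_eq_zero_of_bounded_atBot (A : E →L[ℝ] E)
    (hA : ∀ μ : ℂ, Polynomial.aeval μ (LinearMap.charpoly (A : E →ₗ[ℝ] E)) = 0 → μ.re < 0) :
    ∃ η > 0, ∀ (w w' : ℝ → E) (S M : ℝ), (∀ t ≤ S, HasDerivAt w (w' t) t) →
      (∀ t ≤ S, ‖w' t - A (w t)‖ ≤ η * ‖w t‖) → (∀ t ≤ S, ‖w t‖ ≤ M) → ∀ t ≤ S, w t = 0 := by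
  obtain ⟨T, hT, hTA⟩ := exists_forall_exists_norm_le A hA (show (0 : ℝ) < 1 / 4 by norm_num)
  -- Over one window of length `T`, `Γ` bounds the growth of `w` (as `η ≤ 1`), and the perturbation
  -- contributes at most `η * Γ * G ≤ 1 / 4` times `‖w s‖`. Together with the contraction by `1 / 4`
  -- this yields the factor `1 / 2`.
  set Γ := Real.exp ((‖A‖ + 1) * T) with hΓ
  set G := gronwallBound 0 ‖A‖ 1 T with hG
  have hG0 : 0 ≤ G := by
    have := gronwallBound_mono le_rfl zero_le_one (norm_nonneg A) hT.le
    rwa [gronwallBound_x0] at this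
  have hΓ0 : 0 < Γ := Real.exp_pos _
  set η := min 1 (1 / (4 * (Γ * (G + 1)))) with hη
  have hη0 : 0 < η := by positivity
  have hηG : η * Γ * G ≤ 1 / 4 := by
    have h1 : η * (4 * (Γ * (G + 1))) ≤ 1 := by
      rw [← le_div_iff₀ (by positivity)]; exact min_le_right _ _
    have h2 : 0 ≤ η * Γ := by positivity
    nlinarith
  refine ⟨η, hη0, fun w w' S M hw hwA hM => ?_⟩
  have hstep : ∀ s, s + T ≤ S → ‖w (s + T)‖ ≤ 1 / 2 * ‖w s‖ := by
    intro s hs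
    have hwc : ContinuousOn w (Icc s (s + T)) := fun t ht =>
      (hw t (ht.2.trans hs)).continuousAt.continuousWithinAt
    have hwd : ∀ t ∈ Ico s (s + T), HasDerivWithinAt w (w' t) (Ici t) t := fun t ht =>
      (hw t (ht.2.le.trans hs)).hasDerivWithinAt
    have hgrow : ∀ t ∈ Icc s (s + T), ‖w t‖ ≤ Γ * ‖w s‖ := by
      intro t ht
      have := norm_le_gronwallBound_of_norm_deriv_right_le (K := ‖A‖ + 1) (ε := 0) hwc hwd le_rfl
        (fun t ht => ?_) t ht
      · rw [gronwallBound_ε0] at this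
        refine this.trans ?_
        rw [mul_comm]
        gcongr
        exact Real.exp_le_exp.2 (by gcongr; linarith [ht.2])
      · have h1 := hwA t (ht.2.le.trans hs)
        have h2 : η * ‖w t‖ ≤ 1 * ‖w t‖ := by gcongr; exact min_le_left _ _
        have h3 := A.le_opNorm (w t)
        have h4 := norm_le_norm_sub_add (w' t) (A (w t))
        linarith
    obtain ⟨u, hu0, hu, huT⟩ := hTA (w s)
    have hz : IsIntegralCurve (fun t => u (t + -s)) fun _ => A := hu.comp_add_autonomous (-s)
    have := dist_le_of_approx_trajectories_ODE (v := fun _ => A) (K := ‖A‖₊) (δ := 0)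
      (εf := η * (Γ * ‖w s‖)) (εg := 0) (fun _ => A.lipschitz) hwc hwd (fun t ht => ?_)
      hz.continuous.continuousOn (fun t _ => (hz t).hasDerivWithinAt)
      (fun t _ => (dist_self _).le) (by simp [hu0]) (s + T) ⟨by linarith, le_rfl⟩
    · rw [add_zero, add_sub_cancel_left, gronwallBound_zero_left_eq_mul, coe_nnnorm, ← hG,
        add_neg_cancel_comm, dist_eq_norm] at this
      have h1 := norm_le_norm_sub_add (w (s + T)) (u T)
      have h2 : η * (Γ * ‖w s‖) * G ≤ 1 / 4 * ‖w s‖ := by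
        calc _ = η * Γ * G * ‖w s‖ := by ring
          _ ≤ _ := by gcongr
      linarith
    · rw [dist_eq_norm]
      refine (hwA t (ht.2.le.trans hs)).trans ?_
      gcongr
      exact hgrow t (Ico_subset_Icc_self ht)
  -- Going back `k` windows, where `w` is still bounded by `M`, gains the factor `(1 / 2) ^ k`.
  have hiter : ∀ k : ℕ, ∀ t ≤ S, ‖w t‖ ≤ (1 / 2) ^ k * M := by
    intro k
    induction k with
    | zero => simpa using hM
    | succ k ih =>
      intro t ht
      have h1 := hstep (t - T) (by linarith)
      rw [sub_add_cancel] at h1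
      have h2 := ih (t - T) (by linarith)
      rw [pow_succ']
      linarith
  intro t ht
  have hlim : Tendsto (fun k : ℕ => (1 / 2 : ℝ) ^ k * M) atTop (𝓝 0) := by
    simpa using (tendsto_pow_atTop_nhds_zero_of_lt_one (r := (1 / 2 : ℝ)) (by norm_num)
      (by norm_num)).mul_const M
  exact norm_le_zero_iff.1 (ge_of_tendsto' hlim fun k => hiter k t ht)

end Hurwitz

/-! ### Inflowing families and pullback solutions -/

section Inflowing

variable {E : Type*} [NormedAddCommGroup E] [NormedSpace ℝ E]

/-- A growing family of closed sets `K s` into which the fields `h · (Λ s)` point. -/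
structure IsInflowingFamily (h : E → ℝ → E) (Λ : ℝ → ℝ) (K : ℝ → Set E) : Prop where
  isClosed : ∀ s, IsClosed (K s)
  mono : Monotone K
  inward : ∀ s, ∀ x ∈ K s, ∀ᶠ τ in 𝓝[>] (0 : ℝ), x + τ • h x (Λ s) ∈ K s

theorem eventually_mem_of_pointsStrictlyInto {v x : E} {C : Set E} (hC : IsClosed C) (hx : x ∈ C)
    (h : x ∈ frontier C → PointsStrictlyInto v x C) : ∀ᶠ τ in 𝓝[>] (0 : ℝ), x + τ • v ∈ C := by
  by_cases hxi : x ∈ interior C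
  · have hc : Tendsto (fun τ : ℝ => x + τ • v) (𝓝[>] 0) (𝓝 x) := by
      have : Continuous fun τ : ℝ => x + τ • v := by fun_prop
      simpa using (this.tendsto 0).mono_left nhdsWithin_le_nhds
    exact hc.eventually (mem_interior_iff_mem_nhds.1 hxi)
  · obtain ⟨ε, hε, hin⟩ := h (hC.frontier_eq ▸ ⟨hx, hxi⟩)
    filter_upwards [Ioo_mem_nhdsGT hε] with τ hτ
    exact interior_subset (hin τ hτ.1 hτ.2)

variable {h : E → ℝ → E} {L : NNReal} {Λ : ℝ → ℝ} {K : ℝ → Set E}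

theorem IsInflowingFamily.mem_of_le [ProperSpace E] (hK : IsInflowingFamily h Λ K)
    (hL : LipschitzWith L (Function.uncurry h)) {r : ℝ} (hr : 0 ≤ r) {y : ℝ → E}
    (hy : IsIntegralCurve y fun t x => h x (Λ (r * t))) {a t : ℝ} (ha : y a ∈ K (r * a))
    (hat : a ≤ t) : y t ∈ K (r * t) :=
  hy.mem_of_forall_eventually_mem (C := fun t => K (r * t)) (fun _ => hL.curry_left _)
    (fun _ => hK.isClosed _) (fun _ _ hst => hK.mono (mul_le_mul_of_nonneg_left hst hr))
    (fun _ => hK.inward _) ha hat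

theorem IsInflowingFamily.mem_of_tendsto_atBot [ProperSpace E] (hK : IsInflowingFamily h Λ K)
    (hL : LipschitzWith L (Function.uncurry h)) {r : ℝ} (hr : 0 ≤ r) {y : ℝ → E}
    (hy : IsIntegralCurve y fun t x => h x (Λ (r * t))) {p : E} (hp : p ∈ interior (⋂ s, K s))
    (hyp : Tendsto y atBot (𝓝 p)) (t : ℝ) : y t ∈ K (r * t) := by
  have hev := (hyp.eventually (mem_interior_iff_mem_nhds.1 hp)).and (eventually_le_atBot t)
  obtain ⟨a, ha, hat⟩ := hev.exists
  exact hK.mem_of_le hL hr hy (mem_iInter.1 ha _) hat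

/-- The closed union of an inflowing family is invariant under the limiting equation. -/
theorem IsInflowingFamily.mem_closure_iUnion [ProperSpace E] (hK : IsInflowingFamily h Λ K)
    (hL : LipschitzWith L (Function.uncurry h)) {C : NNReal} (hb : ∀ x l, ‖h x l‖ ≤ C)
    (hΛc : Continuous Λ) {l : ℝ} (hΛ : Tendsto Λ atTop (𝓝 l)) {y : ℝ → E}
    (hy : IsIntegralCurve y fun _ x => h x l) (h0 : y 0 ∈ closure (⋃ s, K s)) {t : ℝ}
    (ht : 0 ≤ t) : y t ∈ closure (⋃ s, K s) := by
  refine Metric.mem_closure_iff.2 fun ε hε => ?_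
  obtain ⟨q, hq, hqd⟩ := Metric.mem_closure_iff.1 h0 (ε / 2 * Real.exp (-(L * t)))
    (by positivity)
  obtain ⟨s, hs⟩ := mem_iUnion.1 hq
  obtain ⟨z, rfl, hz⟩ := exists_isIntegralCurve_parameter hL hb
    (continuous_const : Continuous fun _ : ℝ => l) 0 q
  obtain ⟨η, hη, hcomp⟩ := exists_forall_dist_le_of_parameter_close hL t (half_pos hε)
  -- The trap concerns the nonautonomous equation, so the limiting solution is shadowed by one
  -- started at a late time `τ ≥ s`, which remains in the sets `K`.
  obtain ⟨τ, hτη, hsτ⟩ := ((eventually_atTop.1 (Metric.tendsto_nhds.1 hΛ η hη)).elim fun N hN =>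
    (⟨max N s, fun u hu => (hN u ((le_max_left _ _).trans hu)).le, le_max_right _ _⟩ :
      ∃ τ : ℝ, (∀ u, τ ≤ u → |Λ u - l| ≤ η) ∧ s ≤ τ))
  obtain ⟨u, hu0, hu⟩ := exists_isIntegralCurve_parameter hL hb hΛc τ (z 0)
  have hzτ : IsIntegralCurve (fun t => z (t + -τ)) fun _ x => h x l := hz.comp_add_autonomous (-τ)
  have h1 : dist (u (τ + t)) (z t) ≤ ε / 2 := by
    have := hcomp Λ (fun _ => l) u _ τ (τ + t) le_rfl hu hzτ (by simp [hu0])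
      (fun v hv => hτη v hv.1) (τ + t) ⟨by linarith, le_rfl⟩
    rwa [add_neg_cancel_comm] at this
  have h2 : dist (y t) (z t) < ε / 2 := by
    refine (hy.dist_le_of_le (fun _ => hL.curry_left l) hz ht).trans_lt ?_
    calc _ < ε / 2 * Real.exp (-(L * t)) * Real.exp (L * (t - 0)) := by gcongr
      _ = ε / 2 := by rw [mul_assoc, ← Real.exp_add]; simp
  have h3 : u (τ + t) ∈ K (1 * (τ + t)) := by
    refine hK.mem_of_le hL zero_le_one (y := u) (a := τ) (by simpa using hu) ?_ (by linarith)
    rw [hu0, one_mul]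
    exact hK.mono hsτ hs
  refine ⟨u (τ + t), mem_iUnion.2 ⟨_, h3⟩, ?_⟩
  rw [dist_comm] at h1
  linarith [dist_triangle (y t) (z t) (u (τ + t))]

/-- Solutions in the union of an inflowing family converge to the limiting attractor whose basin
contains the closed union. -/
theorem IsInflowingFamily.tendsto_atTop [ProperSpace E] (hK : IsInflowingFamily h Λ K)
    (hL : LipschitzWith L (Function.uncurry h)) {C : NNReal} (hb : ∀ x l, ‖h x l‖ ≤ C)
    (hΛc : Continuous Λ) {l : ℝ} (hΛ : Tendsto Λ atTop (𝓝 l)) {f : E → ℝ → E} {I : Set ℝ}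
    (hfh : ∀ᶠ q in 𝓝ˢ (closure (⋃ s, K s) ×ˢ I), Function.uncurry h q = Function.uncurry f q)
    (hl : l ∈ I) {U : Set E} {p : E} (hp : IsAttractingEquilibrium (fun x => f x l) U p)
    (hpK : p ∈ interior (closure (⋃ s, K s))) (hcomp : IsCompact (closure (⋃ s, K s)))
    (hbasin : closure (⋃ s, K s) ⊆ basin (fun x => f x l) U p) {r : ℝ} (hr : 0 < r) {y : ℝ → E}
    (hy : IsIntegralCurve y fun t x => h x (Λ (r * t))) (hyK : ∀ t, y t ∈ K (r * t)) :
    Tendsto y atTop (𝓝 p) := by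
  have hstab := fun (ε : ℝ) (hε : ε > 0) =>
    hp.exists_forall_integralCurve hL hfh hl (mem_interior_iff_mem_nhds.1 hpK) hε
  refine hy.tendsto_of_uniform_attraction hL hb (μ := fun t => Λ (r * t))
    (hΛ.comp (tendsto_id.const_mul_atTop hr)) (P := closure (⋃ s, K s)) (a := 0)
    (fun ε hε => hcomp.exists_forall_dist_lt_of_stable (hL.curry_left l)
      (fun x => exists_isIntegralCurve_parameter hL hb continuous_const 0 x)
      (fun ε hε => (hstab ε hε).imp fun δ h => ⟨h.1, fun y hy h0 => (h.2 y hy h0).1⟩)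
      (fun z hz hz0 => ?_) hε)
    (fun t _ => subset_closure (mem_iUnion.2 ⟨_, hyK t⟩))
  -- The basin is defined by solutions for `f`; invariance of `K₊` under the limiting equation for
  -- `h` identifies them with solutions for `h`.
  obtain ⟨x, hx0, hx, hxp⟩ := hbasin hz0
  have heq : EqOn x z (Ici 0) := hx.eqOn_integralCurve hL hfh hl hz
    (fun t ht _ => hK.mem_closure_iUnion hL hb hΛc hΛ hz hz0 ht) hx0
  refine hxp.congr' ?_
  filter_upwards [eventually_ge_atTop 0] with t ht using heq ht

theorem IsInflowingFamily.isPullbackSolution_top [ProperSpace E] (hK : IsInflowingFamily h Λ K)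
    (hL : LipschitzWith L (Function.uncurry h)) {f : E → ℝ → E} {I : Set ℝ} {U : Set E}
    (hfh : ∀ᶠ q in 𝓝ˢ (closure (⋃ s, K s) ×ˢ I), Function.uncurry h q = Function.uncurry f q)
    (hΛI : ∀ s, Λ s ∈ I) (hU : closure (⋃ s, K s) ⊆ U) {r : ℝ} (hr : 0 ≤ r) {p : E}
    (hp : p ∈ interior (⋂ s, K s)) {y : ℝ → E}
    (hy : IsIntegralCurve y fun t x => h x (Λ (r * t))) (hyp : Tendsto y atBot (𝓝 p)) :
    IsPullbackSolution f U Λ r p ⊤ y where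
  bot_lt := bot_lt_top
  solution t _ := by
    have hmem : y t ∈ closure (⋃ s, K s) :=
      subset_closure (mem_iUnion.2 ⟨_, hK.mem_of_tendsto_atBot hL hr hy hp hyp t⟩)
    have e : h (y t) (Λ (r * t)) = f (y t) (Λ (r * t)) :=
      hfh.self_of_nhdsSet (y t, Λ (r * t)) ⟨hmem, hΛI _⟩
    exact ⟨hU hmem, e ▸ hy t⟩
  tendsto_atBot := hyp

/-- Every pullback solution is the restriction of a global solution. -/
theorem IsPullbackSolution.exists_isIntegralCurve [ProperSpace E] (hK : IsInflowingFamily h Λ K)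
    (hL : LipschitzWith L (Function.uncurry h)) {C : NNReal} (hb : ∀ x l, ‖h x l‖ ≤ C)
    (hΛc : Continuous Λ) {f : E → ℝ → E} {I : Set ℝ} {U : Set E}
    (hfh : ∀ᶠ q in 𝓝ˢ (closure (⋃ s, K s) ×ˢ I), Function.uncurry h q = Function.uncurry f q)
    (hΛI : ∀ s, Λ s ∈ I) {r : ℝ} (hr : 0 ≤ r) {p : E} (hp : p ∈ interior (⋂ s, K s))
    {b : EReal} {x : ℝ → E} (hx : IsPullbackSolution f U Λ r p b x) :
    ∃ y : ℝ → E, IsIntegralCurve y (fun t x => h x (Λ (r * t))) ∧ Tendsto y atBot (𝓝 p) ∧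
      ∀ t : ℝ, (t : EReal) < b → x t = y t := by
  have hμc : Continuous fun t => Λ (r * t) := hΛc.comp (continuous_const.mul continuous_id)
  obtain ⟨β, -, hβ⟩ := EReal.lt_iff_exists_real_btwn.1 hx.bot_lt
  obtain ⟨N, hN⟩ := eventually_atBot.1
    (hx.tendsto_atBot.eventually (mem_interior_iff_mem_nhds.1 hp))
  set c := min N β with hc
  have hcb : (c : EReal) < b := lt_of_le_of_lt (EReal.coe_le_coe_iff.2 (min_le_right _ _)) hβ
  have hmem : ∀ t ≤ c, x t ∈ closure (⋃ s, K s) := fun t ht =>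
    subset_closure (mem_iUnion.2 ⟨0, mem_iInter.1 (hN t (ht.trans (min_le_left _ _))) 0⟩)
  have hlt : ∀ {s t : ℝ}, s ≤ t → (t : EReal) < b → (s : EReal) < b := fun hst ht =>
    lt_of_le_of_lt (EReal.coe_le_coe_iff.2 hst) ht
  have hEq : ∀ {z : ℝ → E} {s t : ℝ}, IsIntegralCurve z (fun t x => h x (Λ (r * t))) →
      (t : EReal) < b → x s = z s → (∀ u ∈ Ico s t, x u = z u → z u ∈ closure (⋃ s, K s)) →
      EqOn x z (Icc s t) := fun hz ht h0 hP =>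
    hz.eqOn_of_eventually_eq hL hfh hμc (fun t => hΛI _)
      (fun u hu => (hx.solution u (hlt hu.2 ht)).2.continuousAt.continuousWithinAt)
      (fun u hu => (hx.solution u (hlt hu.2.le ht)).2.hasDerivWithinAt) hP h0
  obtain ⟨y, hy0, hy⟩ := exists_isIntegralCurve_parameter hL hb hμc c (x c)
  -- Comparison of `f` with `h` only runs forward in time, so a solution for `h` is started at `x
  -- t`, followed up to `c`, and identified with `y` by uniqueness.
  have hback : ∀ t ≤ c, x t = y t := by
    intro t ht
    obtain ⟨z, hz0, hz⟩ := exists_isIntegralCurve_parameter hL hb hμc t (x t)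
    have := hEq hz hcb hz0.symm (fun u hu e => e ▸ hmem u hu.2.le) ⟨ht, le_rfl⟩
    rw [hy.eq_of_lipschitzWith (fun t => hL.curry_left _) hz (hy0.trans this), hz0]
  have hyp : Tendsto y atBot (𝓝 p) := hx.tendsto_atBot.congr' <| by
    filter_upwards [eventually_le_atBot c] with t ht using hback t ht
  refine ⟨y, hy, hyp, fun t ht => ?_⟩
  rcases le_total t c with htc | hct
  · exact hback t htc
  · exact hEq hy ht hy0.symm (fun u _ _ => subset_closure
      (mem_iUnion.2 ⟨_, hK.mem_of_tendsto_atBot hL hr hy hp hyp u⟩)) ⟨hct, le_rfl⟩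

/-- If the linearization at `(p, l)` is Hurwitz, any two solutions emanating from `p` meet. -/
theorem IsPullbackSolution.exists_eq_of_hurwitz [FiniteDimensional ℝ E] {f : E → ℝ → E} {U : Set E}
    {p : E} {l : ℝ} (hf : ContDiffAt ℝ 1 (Function.uncurry f) (p, l))
    (hA : ∀ μ : ℂ, Polynomial.aeval μ
      (LinearMap.charpoly (fderiv ℝ (fun x => f x l) p : E →ₗ[ℝ] E)) = 0 → μ.re < 0)
    (hΛ : Tendsto Λ atBot (𝓝 l)) {r : ℝ} (hr : 0 < r) {x y : ℝ → E}
    (hx : IsPullbackSolution f U Λ r p ⊤ x) (hy : IsPullbackSolution f U Λ r p ⊤ y) :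
    ∃ t, x t = y t := by
  obtain ⟨η, hη, hzero⟩ := exists_forall_eq_zero_of_bounded_atBot _ hA
  -- Strict differentiability is needed because both arguments vary. The parameter components of the
  -- two points coincide, so only the `x`-derivative acts on the difference.
  have hD := hf.hasStrictFDerivAt one_ne_zero
  set D := fderiv ℝ (Function.uncurry f) (p, l) with hDdef
  have hAD : fderiv ℝ (fun x => f x l) p = D.comp (ContinuousLinearMap.inl ℝ E ℝ) :=
    (HasFDerivAt.comp (g := Function.uncurry f) (f := fun x => (x, l)) p hD.hasFDerivAt
      (hasFDerivAt_prodMk_left p l)).fderiv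
  have hμ : Tendsto (fun t => Λ (r * t)) atBot (𝓝 l) :=
    hΛ.comp (tendsto_id.const_mul_atBot hr)
  have hpair : Tendsto (fun t => ((x t, Λ (r * t)), (y t, Λ (r * t)))) atBot
      (𝓝 ((p, l), (p, l))) :=
    (hx.tendsto_atBot.prodMk_nhds hμ).prodMk_nhds (hy.tendsto_atBot.prodMk_nhds hμ)
  have hsub : Tendsto (fun t => ‖x t - y t‖) atBot (𝓝 0) := by
    simpa using (hx.tendsto_atBot.sub hy.tendsto_atBot).norm
  obtain ⟨S, hS⟩ := eventually_atBot.1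
    ((hpair.eventually (hD.isLittleO.def hη)).and (hsub.eventually_le_const one_pos))
  refine ⟨S, sub_eq_zero.1 (hzero (fun t => x t - y t)
    (fun t => f (x t) (Λ (r * t)) - f (y t) (Λ (r * t))) S 1
    (fun t _ => ((hx.solution t (EReal.coe_lt_top t)).2.fun_sub
      (hy.solution t (EReal.coe_lt_top t)).2)) (fun t ht => ?_) (fun t ht => (hS t ht).2) S le_rfl)⟩
  have := (hS t ht).1
  rw [hAD]
  simpa [Function.uncurry, Prod.norm_def] using this

end Inflowing

/-! ### The main theorem -/

theorem proposition4p2 {n : ℕ} (U : Set (EuclideanSpace ℝ (Fin n))) (hU : IsOpen U)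
    (f : EuclideanSpace ℝ (Fin n) → ℝ → EuclideanSpace ℝ (Fin n))
    (hf : ContDiffOn ℝ 2 (Function.uncurry f) (U ×ˢ univ))
    (Λ : ℝ → ℝ) (lm lp : ℝ) (hΛ : IsParameterShift Λ lm lp)
    (X : ℝ → EuclideanSpace ℝ (Fin n)) (Xm Xp : EuclideanSpace ℝ (Fin n))
    (hX : IsStablePath f U Λ lm lp X Xm Xp)
    (hFIS : IsForwardInflowingStable f U Λ lp X Xm Xp) :
    (∀ r : ℝ, r > 0 →
      (∃ (b : EReal) (x : ℝ → EuclideanSpace ℝ (Fin n)), IsPullbackAttractor f U Λ r Xm b x) ∧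
      (∀ (b : EReal) (x : ℝ → EuclideanSpace ℝ (Fin n)),
        IsPullbackAttractor f U Λ r Xm b x → EndpointTracks Xp b x) ∧
      (IsLinearlyStable (fun x => f x lm) Xm →
        ∀ (b b' : EReal) (x x' : ℝ → EuclideanSpace ℝ (Fin n)),
          IsPullbackAttractor f U Λ r Xm b x → IsPullbackAttractor f U Λ r Xm b' x' → x = x')) ∧
    ¬ HasRTipping f U Λ Xm Xp := by
  obtain ⟨K, hKc, -, hKmono, hKin, hXm, hXp, hcomp, hbasin⟩ := hFIS
  have hPU : closure (⋃ s, K s) ⊆ U := fun y hy => by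
    obtain ⟨z, rfl, hz, -⟩ := hbasin hy
    exact (hz 0 le_rfl).1
  have hlmlp : lm ≤ lp := ((hΛ.mem_Ioo 0).1.trans (hΛ.mem_Ioo 0).2).le
  have hΛI : ∀ s, Λ s ∈ Icc lm lp := fun s => Ioo_subset_Icc_self (hΛ.mem_Ioo s)
  have hΛc : Continuous Λ := hΛ.contDiff.continuous
  have hW : IsOpen (U ×ˢ (univ : Set ℝ)) := hU.prod isOpen_univ
  have hf1 : ContDiffOn ℝ 1 (Function.uncurry f) (U ×ˢ univ) := hf.of_le one_le_two
  obtain ⟨ψ, ⟨L, hL⟩, ⟨C, hC⟩, hψ⟩ := hf1.exists_lipschitzWith_eventuallyEq hW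
    (hcomp.prod (isCompact_Icc (a := lm) (b := lp))) (prod_mono hPU (subset_univ _))
  obtain ⟨h, rfl⟩ : ∃ h : EuclideanSpace ℝ (Fin n) → ℝ → EuclideanSpace ℝ (Fin n),
      ψ = Function.uncurry h := ⟨Function.curry ψ, (Function.uncurry_curry ψ).symm⟩
  have hb : ∀ x l, ‖h x l‖ ≤ C := fun x l => hC (x, l)
  have hKsub : ∀ s, K s ⊆ closure (⋃ s, K s) := fun s => (subset_iUnion K s).trans subset_closure
  have hK : IsInflowingFamily h Λ K :=
    { isClosed := fun s => (hKc s).isClosed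
      mono := fun s t hst => hst.lt_or_eq.elim (hKmono s t) fun e => e ▸ subset_rfl
      inward := fun s x hx => by
        have e : h x (Λ s) = f x (Λ s) := hψ.self_of_nhdsSet (x, Λ s) ⟨hKsub s hx, hΛI s⟩
        rw [e]
        exact eventually_mem_of_pointsStrictlyInto (hKc s).isClosed hx (hKin s x) }
  have hXmP : closure (⋃ s, K s) ∈ 𝓝 Xm := mem_of_superset (mem_interior_iff_mem_nhds.1 hXm)
    ((iInter_subset K 0).trans (hKsub 0))
  have hglobal : ∀ {r : ℝ}, 0 < r → ∀ {b : EReal} {x : ℝ → EuclideanSpace ℝ (Fin n)},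
      IsPullbackAttractor f U Λ r Xm b x → b = ⊤ ∧
        IsIntegralCurve x (fun t x => h x (Λ (r * t))) ∧ IsPullbackSolution f U Λ r Xm ⊤ x := by
    intro r hr b x hx
    obtain ⟨y, hy, hyX, hxy⟩ := hx.toIsPullbackSolution.exists_isIntegralCurve hK hL hb hΛc hψ hΛI
      hr.le hXm
    have hys := hK.isPullbackSolution_top hL hψ hΛI hPU hr.le hXm hy hyX
    -- The global solution `y` extends `x`, so maximality forces `b = ⊤`.
    obtain rfl : b = ⊤ := top_le_iff.1 (hx.maximal ⊤ y hys fun t ht _ => (hxy t ht).symm)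
    obtain rfl : x = y := funext fun t => hxy t (EReal.coe_lt_top t)
    exact ⟨rfl, hy, hys⟩
  have htrack : ∀ r : ℝ, r > 0 → ∀ (b : EReal) (x : ℝ → EuclideanSpace ℝ (Fin n)),
      IsPullbackAttractor f U Λ r Xm b x → EndpointTracks Xp b x := by
    intro r hr b x hx
    obtain ⟨hbt, hxc, hxs⟩ := hglobal hr hx
    exact ⟨hbt, hK.tendsto_atTop hL hb hΛc hΛ.tendsto_atTop hψ ⟨hlmlp, le_rfl⟩ hX.attracting_plus
      hXp hcomp hbasin hr hxc (hK.mem_of_tendsto_atBot hL hr.le hxc hXm hxs.tendsto_atBot)⟩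
  refine ⟨fun r hr => ⟨?_, htrack r hr, fun hlin b b' x x' hx hx' => ?_⟩,
    fun ⟨r, hr, b, x, hx, hnot⟩ => hnot (htrack r hr b x hx)⟩
  · obtain ⟨y, hy, hyX⟩ := exists_isIntegralCurve_tendsto_atBot hL hb
      (hΛc.comp (continuous_const.mul continuous_id) : Continuous fun t => Λ (r * t))
      (hΛ.tendsto_atBot.comp (tendsto_id.const_mul_atBot hr))
      (fun ε hε => hX.attracting_minus.exists_forall_integralCurve hL hψ ⟨le_rfl, hlmlp⟩ hXmP hε)
    exact ⟨⊤, y, hK.isPullbackSolution_top hL hψ hΛI hPU hr.le hXm hy hyX,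
      fun _ _ _ _ => le_top⟩
  · obtain ⟨-, hxc, hxs⟩ := hglobal hr hx
    obtain ⟨-, hxc', hxs'⟩ := hglobal hr hx'
    -- One common value suffices, since solutions for `h` are unique in both time directions.
    obtain ⟨t, ht⟩ := hxs.exists_eq_of_hurwitz
      (hf1.contDiffAt (hW.mem_nhds ⟨hX.attracting_minus.mem, mem_univ _⟩)) hlin
      hΛ.tendsto_atBot hr hxs'
    exact hxc.eq_of_lipschitzWith (fun t => hL.curry_left _) hxc' ht
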